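/- Let $X$ be a compact Polish space. A foliated chart of $X$ is an open set $U\subset X$ with a homeomorphism $U\to B\times S$, where $B$ is an open ball of a Euclidean space and $S$ is a Polish space; its plaques are the sets corresponding to $B\times\{s\}$, and $U\to S$ is its projection. Let $\mathcal F$ be a lamination on $X$, i.e. a maximal atlas of foliated charts whose coordinate changes are locally of the form $(x,s)\mapsto(f(x,s),g(s))$. The plaques of all its charts generate the leaf topology of $X$, whose connected components are the leaves; the leaves of the restriction $\mathcal F_V$ to an open set $V$ are the connected components of $V$ in the leaf topology. Let $\mathcal U=\{U_1,\dots,U_N\}$ be a finite regular atlas of $\mathcal F$, with projections $\pi_i:U_i\to S_i$: a finite family of charts of $\mathcal F$ covering $X$ such that each plaque of $U_i$ meets at most one plaque of $U_j$, and such that, whenever $U_i\cap U_j\neq\emptyset$, there is a chart of $\mathcal F$ containing $U_i\cup U_j$ in which distinct plaques of $U_i$ lie in distinct plaques, and likewise for $U_j$. Let $\Lambda$ be a transverse invariant measure of $\mathcal F$, regular and finite on compact sets, given as a family of Borel measures on the spaces $S_i$ that is invariant by the holonomy transformations $g_{ij}$ between them ($\pi_i=g_{ij}\circ\pi_j$ on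 $U_i\cap U_j$), and extended to Borel sets $B\subset X$ that meet each leaf in a countable set by $$\Lambda(B)=\sum_{i}\int_{S_i}\#\Big(\big(B\cap U_i\setminus\textstyle\bigcup_{j<i}U_j\big)\cap\pi_i^{-1}(s)\Big)\,d\Lambda(s).$$ A tangential contraction of an open set $V\subset X$ is a continuous map $H:V\times[0,1]\to X$ such that $H(x,0)=x$, for each leaf $L$ of $\mathcal F_V$ the set $H(L\times[0,1])$ is contained in a leaf of $\mathcal F$, and $H(\cdot,1)$ is constant on each leaf of $\mathcal F_V$. The length of a path is the least number of plaques in a chain of plaques of $\mathcal U$ (a finite sequence of plaques, each meeting the next one) that covers the path, and the length of $H$ is the supremum of the lengths of the paths $H(x,\cdot)$. Let $$\operatorname{Cat}(\mathcal F,\Lambda,n,\mathcal U)=\inf_{\mathcal V}\sum_{V\in\mathcal V}\inf_H\Lambda(H(V\times\{1\})),$$ where $\mathcal V$ runs over the open coverings of $X$ and $H$ over the tangential contractions of $V$ of length at most $n$ (with $\inf\emptyset=\infty$). Let $\operatorname{Cat}(\mathcal F,\Lambda)$ be defined in the same way without restriction on the length, and assume that $\operatorname{Cat}(\mathcal F,\Lambda)=0$.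 Let $T\subset X$ be a complete transversal: for every chart $U\to B\times S$ of $\mathcal F$ the projection restricts to a local homeomorphism $U\cap T\to S$, and $T$ meets every leaf. Let $\operatorname{Cat}(\mathcal F,\Lambda,n,\mathcal U,T)$ be defined like $\operatorname{Cat}(\mathcal F,\Lambda,n,\mathcal U)$, using only tangential contractions $H$ with $H(V\times\{1\})\subset T$. Then the growth types of the non-decreasing sequences $$\frac1{\operatorname{Cat}(\mathcal F,\Lambda,n,\mathcal U)}\quad\text{and}\quad\frac1{\operatorname{Cat}(\mathcal F,\Lambda,n,\mathcal U,T)}\qquad(n\in\mathbb N)$$ are equal. Here $1/\infty=0$, $1/0=\infty$, and two non-decreasing sequences $g,h:\mathbb N\to[0,\infty]$ have the same growth type if $g\preceq h\preceq g$, where $g\preceq h$ means that there are $B\in\mathbb N$ and a real $A>0$ with $g(n)\le A\,h(Bn)$ for all $n\in\mathbb N$. -/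

import Mathlib

open Set Topology MeasureTheory
open scoped ENNReal unitInterval

universe u

/-- A foliated chart of `X`: an open set `U` with a homeomorphism onto the product of an open ball
of a Euclidean space and a Polish space `S`. -/
structure FoliatedChart (X : Type u) [TopologicalSpace X] where
  U : Set X
  isOpen_U : IsOpen U
  dim : ℕ
  center : EuclideanSpace ℝ (Fin dim)
  radius : ℝ
  radius_pos : 0 < radius
  S : Type u
  topS : TopologicalSpace S
  polishS : PolishSpace S
  homeo : U ≃ₜ Metric.ball center radius × S

namespace FoliatedChart

variable {X : Type u} [TopologicalSpace X]

instance instTopologicalSpaceS (φ : FoliatedChart X) : TopologicalSpace φ.S := φ.topS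

instance instPolishSpaceS (φ : FoliatedChart X) : PolishSpace φ.S := φ.polishS

/-- The transverse factor carries its Borel sigma-algebra. -/
instance instMeasurableSpaceS (φ : FoliatedChart X) : MeasurableSpace φ.S := borel φ.S

instance instBorelSpaceS (φ : FoliatedChart X) : BorelSpace φ.S := ⟨rfl⟩

/-- The projection `U → S` of a chart. -/
def proj (φ : FoliatedChart X) (x : φ.U) : φ.S := (φ.homeo x).2

/-- The plaque of a chart over the point `s` of the transverse factor. -/
def plaque (φ : FoliatedChart X) (s : φ.S) : Set X := {x | ∃ h : x ∈ φ.U, φ.proj ⟨x, h⟩ = s}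

/-- The change of coordinates from `φ` to `ψ` is locally of the form `(x, s) ↦ (f (x, s), g s)`:
the transverse `ψ`-coordinate is locally a function of the transverse `φ`-coordinate. -/
def Compatible (φ ψ : FoliatedChart X) : Prop :=
  ∀ x ∈ φ.U ∩ ψ.U, ∃ g : φ.S → ψ.S, ∀ᶠ y in 𝓝 x,
    ∀ (h : y ∈ φ.U) (h' : y ∈ ψ.U), ψ.proj ⟨y, h'⟩ = g (φ.proj ⟨y, h⟩)

end FoliatedChart

/-- A lamination on `X`: a maximal foliated atlas. -/
structure Lamination (X : Type u) [TopologicalSpace X] where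
  charts : Set (FoliatedChart X)
  covers : ∀ x, ∃ φ ∈ charts, x ∈ φ.U
  compatible : ∀ φ ∈ charts, ∀ ψ ∈ charts, φ.Compatible ψ
  maximal : ∀ φ : FoliatedChart X,
    (∀ ψ ∈ charts, φ.Compatible ψ ∧ ψ.Compatible φ) → φ ∈ charts

namespace Lamination

variable {X : Type u} [TopologicalSpace X]

/-- The leaf topology, generated by the plaques of all charts of the lamination. -/
@[reducible] def leafTopology (F : Lamination X) : TopologicalSpace X :=
  TopologicalSpace.generateFrom {P | ∃ φ ∈ F.charts, ∃ s : φ.S, P = φ.plaque s}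

/-- The leaf through `x`: its connected component in the leaf topology. -/
def leaf (F : Lamination X) (x : X) : Set X := @connectedComponent X F.leafTopology x

/-- The leaf through `x` of the restriction of the lamination to a set `V`: the connected
component of `x` in `V` with respect to the leaf topology. -/
def leafIn (F : Lamination X) (V : Set X) (x : X) : Set X :=
  @connectedComponentIn X F.leafTopology V x

/-- A transversal: in every chart, the projection restricts to a local homeomorphism
`U ∩ T → S`. -/
def IsTransversal (F : Lamination X) (T : Set X) : Prop :=
  ∀ φ ∈ F.charts, IsLocalHomeomorph (fun x : {x : φ.U // (x : X) ∈ T} => φ.proj x.1)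

/-- A complete transversal: a transversal that meets every leaf. -/
def IsCompleteTransversal (F : Lamination X) (T : Set X) : Prop :=
  F.IsTransversal T ∧ ∀ x, (F.leaf x ∩ T).Nonempty

/-- A tangential deformation of `V`: a continuous map `V × [0,1] → X` that starts at the inclusion
and sends each product of a leaf of the restricted lamination with `[0,1]` into a leaf. -/
structure IsTangentialDeformation (F : Lamination X) (V : Set X) (H : C(V × I, X)) : Prop where
  map_zero : ∀ x : V, H (x, 0) = x
  foliated : ∀ x y : V, (y : X) ∈ F.leafIn V x → ∀ s t : I, H (y, t) ∈ F.leaf (H (x, s))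

/-- A tangential contraction of `V`: a tangential deformation whose final map is constant on the
leaves of the restricted lamination. -/
structure IsTangentialContraction (F : Lamination X) (V : Set X) (H : C(V × I, X)) : Prop
    extends F.IsTangentialDeformation V H where
  const_one : ∀ x y : V, (y : X) ∈ F.leafIn V x → H (y, 1) = H (x, 1)

end Lamination

/-- The final set `H (V × {1})` of a homotopy. -/
def finalSet {X : Type u} [TopologicalSpace X] {V : Set X} (H : C(V × I, X)) : Set X :=
  range fun x : V => H (x, 1)

/-- A finite regular foliated atlas of the lamination `F` (local finiteness is automatic). -/
structure RegularAtlas {X : Type u} [TopologicalSpace X] (F : Lamination X) where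
  N : ℕ
  chart : Fin N → FoliatedChart X
  mem_charts : ∀ i, chart i ∈ F.charts
  covers : ∀ x, ∃ i, x ∈ (chart i).U
  /-- A plaque of one chart meets at most one plaque of another chart. -/
  plaque_unique : ∀ i j (x y : X) (hxi : x ∈ (chart i).U) (hyi : y ∈ (chart i).U)
    (hxj : x ∈ (chart j).U) (hyj : y ∈ (chart j).U),
    (chart i).proj ⟨x, hxi⟩ = (chart i).proj ⟨y, hyi⟩ →
      (chart j).proj ⟨x, hxj⟩ = (chart j).proj ⟨y, hyj⟩
  /-- Two charts that meet are restrictions of a common chart of the lamination, up to changes of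
  coordinates that induce an injection between the sets of plaques. -/
  common_chart : ∀ i j, ((chart i).U ∩ (chart j).U).Nonempty →
    ∃ ψ ∈ F.charts, ∀ k, k = i ∨ k = j → ∃ hU : (chart k).U ⊆ ψ.U,
      ∃ g : (chart k).S → ψ.S, Function.Injective g ∧
        ∀ x : (chart k).U, ψ.proj ⟨x, hU x.2⟩ = g ((chart k).proj x)

namespace RegularAtlas

variable {X : Type u} [TopologicalSpace X] {F : Lamination X}

/-- The plaques of the atlas, indexed by a chart and a point of its transverse factor. -/
abbrev PlaqueIndex (𝒰 : RegularAtlas F) : Type u := Σ i : Fin 𝒰.N, (𝒰.chart i).S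

/-- The plaque with a given index. -/
def plaque (𝒰 : RegularAtlas F) (p : 𝒰.PlaqueIndex) : Set X := (𝒰.chart p.1).plaque p.2

/-- A chain of plaques: a nonempty finite sequence in which each plaque meets the next one. -/
def IsPlaqueChain (𝒰 : RegularAtlas F) (c : List 𝒰.PlaqueIndex) : Prop :=
  c ≠ [] ∧ c.IsChain fun p q => (𝒰.plaque p ∩ 𝒰.plaque q).Nonempty

/-- The length of a path: the minimum number of plaques in a chain of plaques covering it
(infinite if there is none). -/
noncomputable def pathLength (𝒰 : RegularAtlas F) (γ : I → X) : ℕ∞ :=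
  ⨅ (c : List 𝒰.PlaqueIndex) (_ : 𝒰.IsPlaqueChain c ∧ ∀ t, ∃ p ∈ c, γ t ∈ 𝒰.plaque p),
    (c.length : ℕ∞)

/-- The length of a homotopy: the supremum of the lengths of its paths. -/
noncomputable def homotopyLength (𝒰 : RegularAtlas F) {V : Set X} (H : C(V × I, X)) : ℕ∞ :=
  ⨆ x : V, 𝒰.pathLength fun t => H (x, t)

/-- The image of `E` under the holonomy transformation from chart `i` to chart `j`. -/
def holonomyImage (𝒰 : RegularAtlas F) (i j : Fin 𝒰.N) (E : Set (𝒰.chart i).S) :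
    Set (𝒰.chart j).S :=
  {t | ∃ x, ∃ (hi : x ∈ (𝒰.chart i).U) (hj : x ∈ (𝒰.chart j).U),
    (𝒰.chart i).proj ⟨x, hi⟩ ∈ E ∧ (𝒰.chart j).proj ⟨x, hj⟩ = t}

/-- The domain of the holonomy transformation from chart `i` to chart `j`. -/
def holonomyDomain (𝒰 : RegularAtlas F) (i j : Fin 𝒰.N) : Set (𝒰.chart i).S :=
  {s | ∃ x, ∃ hi : x ∈ (𝒰.chart i).U, x ∈ (𝒰.chart j).U ∧ (𝒰.chart i).proj ⟨x, hi⟩ = s}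

/-- The part of `U_i` outside the previous charts; these sets form a partition of `X`. -/
def cell (𝒰 : RegularAtlas F) (i : Fin 𝒰.N) : Set X :=
  (𝒰.chart i).U \ ⋃ j : Fin 𝒰.N, ⋃ _ : j < i, (𝒰.chart j).U

end RegularAtlas

/-- A transverse invariant measure: a Borel measure on the disjoint union of the transverse
factors of the atlas, that is, one on each factor, invariant by the generators of the holonomy
pseudogroup. -/
structure TransverseInvariantMeasure {X : Type u} [TopologicalSpace X] {F : Lamination X}
    (𝒰 : RegularAtlas F) where
  measure : ∀ i : Fin 𝒰.N, Measure (𝒰.chart i).S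
  invariant : ∀ i j (E : Set (𝒰.chart i).S), MeasurableSet E → E ⊆ 𝒰.holonomyDomain i j →
    measure j (𝒰.holonomyImage i j E) = measure i E

namespace TransverseInvariantMeasure

variable {X : Type u} [TopologicalSpace X] {F : Lamination X} {𝒰 : RegularAtlas F}

/-- The extension of a transverse invariant measure to transverse sets `B`: cut `B` along the
charts and, in each chart, integrate the number of points of the piece in each plaque. -/
noncomputable def eval (Λ : TransverseInvariantMeasure 𝒰) (B : Set X) : ℝ≥0∞ :=
  ∑ i : Fin 𝒰.N, ∫⁻ s, ((B ∩ 𝒰.cell i ∩ (𝒰.chart i).plaque s).encard : ℝ≥0∞) ∂Λ.measure i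

/-- Regular and finite on compact sets. -/
def IsRegular (Λ : TransverseInvariantMeasure 𝒰) : Prop := ∀ i, (Λ.measure i).Regular

/-- The infimum of the measures of the final sets of the tangential contractions of `V` that
satisfy `P` (infinite if there is none). -/
noncomputable def tau (Λ : TransverseInvariantMeasure 𝒰)
    (P : ∀ V : Set X, C(V × I, X) → Prop) (V : Set X) : ℝ≥0∞ :=
  ⨅ (H : C(V × I, X)) (_ : F.IsTangentialContraction V H ∧ P V H), Λ.eval (finalSet H)

/-- The measured category computed with the tangential contractions that satisfy `P`. -/
noncomputable def catOf (Λ : TransverseInvariantMeasure 𝒰)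
    (P : ∀ V : Set X, C(V × I, X) → Prop) : ℝ≥0∞ :=
  ⨅ (𝒱 : Set (Set X)) (_ : (∀ V ∈ 𝒱, IsOpen V) ∧ ⋃₀ 𝒱 = univ), ∑' V : 𝒱, Λ.tau P V

/-- The measured category. -/
noncomputable def cat (Λ : TransverseInvariantMeasure 𝒰) : ℝ≥0∞ := Λ.catOf fun _ _ => True

/-- The measured category computed with contractions of length at most `n`. -/
noncomputable def catLen (Λ : TransverseInvariantMeasure 𝒰) (n : ℕ) : ℝ≥0∞ :=
  Λ.catOf fun _ H => 𝒰.homotopyLength H ≤ n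

/-- The measured category computed with contractions of length at most `n` that end in `T`. -/
noncomputable def catLenTo (Λ : TransverseInvariantMeasure 𝒰) (n : ℕ) (T : Set X) : ℝ≥0∞ :=
  Λ.catOf fun _ H => 𝒰.homotopyLength H ≤ n ∧ finalSet H ⊆ T

theorem catOf_anti (Λ : TransverseInvariantMeasure 𝒰) {P Q : ∀ V : Set X, C(V × I, X) → Prop}
    (h : ∀ V H, P V H → Q V H) : Λ.catOf Q ≤ Λ.catOf P := by
  refine iInf₂_mono fun 𝒱 _ => ENNReal.tsum_le_tsum fun V => ?_
  exact le_iInf₂ fun H hH => iInf₂_le H ⟨hH.1, h _ _ hH.2⟩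

theorem catLen_antitone (Λ : TransverseInvariantMeasure 𝒰) : Antitone Λ.catLen :=
  fun _ _ h => Λ.catOf_anti fun _ _ hH => hH.trans (by exact_mod_cast h)

theorem catLenTo_antitone (Λ : TransverseInvariantMeasure 𝒰) (T : Set X) :
    Antitone fun n => Λ.catLenTo n T :=
  fun _ _ h => Λ.catOf_anti fun _ _ hH => ⟨hH.1.trans (by exact_mod_cast h), hH.2⟩

end TransverseInvariantMeasure

/-- Non-decreasing sequences of non-negative extended reals. -/
abbrev GrowthSeq : Type := {g : ℕ → ℝ≥0∞ // Monotone g}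

namespace GrowthSeq

/-- The growth preorder. -/
def Dominated (g h : GrowthSeq) : Prop :=
  ∃ B : ℕ, ∃ A : ℝ, 0 < A ∧ ∀ n, g.1 n ≤ ENNReal.ofReal A * h.1 (B * n)

theorem Dominated.refl (g : GrowthSeq) : Dominated g g := ⟨1, 1, one_pos, fun n => by simp⟩

theorem Dominated.trans {f g h : GrowthSeq} (h₁ : Dominated f g) (h₂ : Dominated g h) :
    Dominated f h := by
  obtain ⟨B, A, hA, hfg⟩ := h₁
  obtain ⟨B', A', hA', hgh⟩ := h₂
  refine ⟨B' * B, A * A', mul_pos hA hA', fun n => (hfg n).trans ?_⟩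
  rw [ENNReal.ofReal_mul hA.le, mul_assoc, mul_assoc]
  gcongr
  exact hgh (B * n)

/-- Two sequences have the same growth if each one is dominated by the other. -/
instance setoid : Setoid GrowthSeq where
  r g h := Dominated g h ∧ Dominated h g
  iseqv :=
    { refl := fun g => ⟨.refl g, .refl g⟩
      symm := fun h => ⟨h.2, h.1⟩
      trans := fun h₁ h₂ => ⟨h₁.1.trans h₂.1, h₂.2.trans h₁.2⟩ }

end GrowthSeq

/-- Growth types of non-decreasing sequences. -/
def GrowthType : Type := Quotient GrowthSeq.setoid

/-- The growth type of the sequence `1 / c n` for a non-increasing sequence `c`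
(with `1 / 0 = ∞` and `1 / ∞ = 0`). -/
noncomputable def growthTypeInv (c : ℕ → ℝ≥0∞) (hc : Antitone c) : GrowthType :=
  Quotient.mk GrowthSeq.setoid
    ⟨fun n => 1 / c n, fun _ _ h => ENNReal.div_le_div_left (hc h) 1⟩

/-! Requiring contractions to end in `T` can only raise the category, so one domination is
immediate. For the other, a contraction of length at most `n` is continued into `T` at bounded cost.
Every point has an open neighborhood `W` with a leafwise deformation into `T` whose paths have
length at most `k` and whose final map multiplies the measure of sigma-compact sets by at most `C`
(`exists_controlledDeformation_transversal`). It is a composition of slides along plaques. A slide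
onto a section stays in single plaques and costs a factor `N` in measure; finitely many slides reach
any point of the leaf. By compactness finitely many such `W` cover `X`. Given a contraction `H` of
`V`, the preimages of the `W` under the final map of `H` cover `V`, and on each one `H` followed by
the deformation is a contraction into `T` (`tau_pullback_le`). Lengths grow to at most `B * n` and
the sum of measures by a factor `A`, both independent of `n` and of the covering, so `catLenTo (B *
n) T ≤ A * catLen n`. -/

/-! ### Sigma-compact sets -/

theorem IsSigmaCompact.inter {Y : Type*} [TopologicalSpace Y] [T2Space Y] {A B : Set Y}
    (hA : IsSigmaCompact A) (hB : IsSigmaCompact B) : IsSigmaCompact (A ∩ B) := by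
  obtain ⟨K, hK, rfl⟩ := hA
  obtain ⟨L, hL, rfl⟩ := hB
  simp_rw [iUnion_inter, inter_iUnion]
  exact isSigmaCompact_iUnion _ fun i => isSigmaCompact_iUnion_of_isCompact _ fun j =>
    (hK i).inter (hL j)

theorem IsSigmaCompact.measurableSet {Y : Type*} [TopologicalSpace Y] [T2Space Y]
    [MeasurableSpace Y] [OpensMeasurableSpace Y] {A : Set Y} (hA : IsSigmaCompact A) :
    MeasurableSet A := by
  obtain ⟨K, hK, rfl⟩ := hA
  exact MeasurableSet.iUnion fun n => (hK n).measurableSet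

theorem IsOpen.isSigmaCompact {Y : Type*} [TopologicalSpace Y] [LocallyCompactSpace Y]
    [SecondCountableTopology Y] {A : Set Y} (hA : IsOpen A) : IsSigmaCompact A := by
  have := hA.locallyCompactSpace
  exact isSigmaCompact_iff_sigmaCompactSpace.2 inferInstance

/-! ### Projections of charts and slides along plaques -/

namespace FoliatedChart

variable {X : Type u} [TopologicalSpace X]

theorem continuous_proj (φ : FoliatedChart X) : Continuous φ.proj :=
  continuous_snd.comp φ.homeo.continuous

theorem mem_plaque_proj (φ : FoliatedChart X) (x : φ.U) : (x : X) ∈ φ.plaque (φ.proj x) :=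
  ⟨x.2, rfl⟩

theorem plaque_nonempty (φ : FoliatedChart X) (s : φ.S) : (φ.plaque s).Nonempty :=
  ⟨φ.homeo.symm (⟨φ.center, Metric.mem_ball_self φ.radius_pos⟩, s), Subtype.prop _, by simp [proj]⟩

/-- The image under the chart projection of the part of `D` inside the chart. -/
def projImage (φ : FoliatedChart X) (D : Set X) : Set φ.S :=
  φ.proj '' ((↑) ⁻¹' D)

theorem projImage_iUnion {ι : Type*} (φ : FoliatedChart X) (D : ι → Set X) :
    φ.projImage (⋃ i, D i) = ⋃ i, φ.projImage (D i) := by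
  simp [projImage, preimage_iUnion, image_iUnion]

theorem projImage_mono (φ : FoliatedChart X) {D E : Set X} (h : D ⊆ E) :
    φ.projImage D ⊆ φ.projImage E :=
  image_mono (preimage_mono h)

theorem projImage_inter_U (φ : FoliatedChart X) (D : Set X) :
    φ.projImage (D ∩ φ.U) = φ.projImage D := by
  simp [projImage]

/-- Projections of Borel sets need not be Borel, but sigma-compactness survives continuous images.
This makes every projection measured below measurable. -/
theorem isSigmaCompact_projImage [T2Space X] [LocallyCompactSpace X] [SecondCountableTopology X]
    (φ : FoliatedChart X) {D : Set X} (hD : IsSigmaCompact D) :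
    IsSigmaCompact (φ.projImage D) := by
  refine IsSigmaCompact.image φ.continuous_proj ?_
  rw [IsEmbedding.subtypeVal.isSigmaCompact_iff, Subtype.image_preimage_coe]
  exact φ.isOpen_U.isSigmaCompact.inter hD

/-- Slide the point `x` inside its plaque towards the `ball` coordinate `b`. -/
noncomputable def slide (φ : FoliatedChart X) (b : Metric.ball φ.center φ.radius) (x : φ.U)
    (t : I) : φ.U :=
  φ.homeo.symm (⟨AffineMap.lineMap ((φ.homeo x).1 : EuclideanSpace ℝ (Fin φ.dim)) b (t : ℝ),
    (convex_ball φ.center φ.radius).lineMap_mem (φ.homeo x).1.2 b.2 t.2⟩, (φ.homeo x).2)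

theorem slide_zero (φ : FoliatedChart X) (b) (x : φ.U) : φ.slide b x 0 = x := by
  simp [slide]

theorem slide_one (φ : FoliatedChart X) (b) (x : φ.U) :
    φ.slide b x 1 = φ.homeo.symm (b, φ.proj x) := by
  simp [slide, proj]

theorem proj_slide (φ : FoliatedChart X) (b) (x : φ.U) (t : I) :
    φ.proj (φ.slide b x t) = φ.proj x := by
  simp [slide, proj]

theorem continuous_slide {Y : Type*} [TopologicalSpace Y] (φ : FoliatedChart X)
    {b : Y → Metric.ball φ.center φ.radius} {x : Y → φ.U} {t : Y → I} (hb : Continuous b)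
    (hx : Continuous x) (ht : Continuous t) : Continuous fun y => φ.slide (b y) (x y) (t y) := by
  unfold slide
  refine φ.homeo.symm.continuous.comp (Continuous.prodMk (Continuous.subtype_mk ?_ _) ?_)
  · simp only [AffineMap.lineMap_apply_module]
    fun_prop
  · fun_prop

end FoliatedChart

/-! ### Plaques and leaves -/

namespace Lamination

variable {X : Type u} [TopologicalSpace X] {F : Lamination X}

theorem isOpen_plaque {φ : FoliatedChart X} (hφ : φ ∈ F.charts) (s : φ.S) :
    IsOpen[F.leafTopology] (φ.plaque s) :=
  TopologicalSpace.isOpen_generateFrom_of_mem ⟨φ, hφ, s, rfl⟩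

/-- The parametrization of the plaque by a ball is continuous even for the leaf topology:
compatibility makes the transverse coordinate of any other chart locally constant along it. -/
theorem isPreconnected_plaque {φ : FoliatedChart X} (hφ : φ ∈ F.charts) (s : φ.S) :
    @IsPreconnected X F.leafTopology (φ.plaque s) := by
  let f : Metric.ball φ.center φ.radius → X := fun b => φ.homeo.symm (b, s)
  have hf : Continuous f := by fun_prop
  have hfU : ∀ b, f b ∈ φ.U := fun b => Subtype.prop _
  have hfp : ∀ b, φ.proj ⟨f b, hfU b⟩ = s := fun b => by simp [f, FoliatedChart.proj]
  have hrange : range f = φ.plaque s := by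
    ext x
    constructor
    · rintro ⟨b, rfl⟩
      exact ⟨hfU b, hfp b⟩
    · rintro ⟨hx, rfl⟩
      exact ⟨(φ.homeo ⟨x, hx⟩).1, by simp [f, FoliatedChart.proj]⟩
  have : PreconnectedSpace (Metric.ball φ.center φ.radius) :=
    isPreconnected_iff_preconnectedSpace.1 (convex_ball _ _).isPreconnected
  rw [← hrange]
  refine @isPreconnected_range _ X _ F.leafTopology _ f ?_
  refine continuous_generateFrom_iff.2 ?_
  rintro _ ⟨ψ, hψ, s', rfl⟩
  refine isOpen_iff_mem_nhds.2 ?_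
  rintro b ⟨hb, hbs⟩
  obtain ⟨g, hg⟩ := F.compatible φ hφ ψ hψ (f b) ⟨hfU b, hb⟩
  filter_upwards [hf.continuousAt.eventually hg,
    hf.continuousAt.eventually (ψ.isOpen_U.mem_nhds hb)] with c hc hcU
  refine ⟨hcU, ?_⟩
  rw [hc (hfU c) hcU, hfp, ← hbs, hg.self_of_nhds (hfU b) hb, hfp]

theorem mem_leaf_of_proj_eq {φ : FoliatedChart X} (hφ : φ ∈ F.charts) {x y : φ.U}
    (h : φ.proj x = φ.proj y) : (y : X) ∈ F.leaf x := by
  have hsub : φ.plaque (φ.proj x) ⊆ F.leaf x :=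
    @IsPreconnected.subset_connectedComponent X F.leafTopology _ _
      (isPreconnected_plaque hφ (φ.proj x)) (φ.mem_plaque_proj x)
  exact hsub ⟨y.2, h.symm⟩

theorem leaf_eq {x y : X} (h : y ∈ F.leaf x) : F.leaf x = F.leaf y :=
  @connectedComponent_eq X F.leafTopology x y h

theorem leafIn_mono {V W : Set X} (h : V ⊆ W) (x : X) : F.leafIn V x ⊆ F.leafIn W x :=
  @connectedComponentIn_mono X F.leafTopology x V W h

end Lamination

/-! ### Plaque chains, path lengths and cells -/

namespace RegularAtlas

variable {X : Type u} [TopologicalSpace X] {F : Lamination X} {𝒰 : RegularAtlas F}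

theorem plaque_nonempty (𝒰 : RegularAtlas F) (p : 𝒰.PlaqueIndex) : (𝒰.plaque p).Nonempty :=
  (𝒰.chart p.1).plaque_nonempty p.2

/-- A set that is a union of plaques and whose complement is one contains the leaves through its
points. -/
theorem leaf_subset (𝒰 : RegularAtlas F) {A : Set X}
    (hA : ∀ i (x y : (𝒰.chart i).U), (𝒰.chart i).proj x = (𝒰.chart i).proj y → ↑x ∈ A → ↑y ∈ A)
    {x : X} (hx : x ∈ A) : F.leaf x ⊆ A := by
  have key : ∀ B : Set X, (∀ i (x y : (𝒰.chart i).U),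
      (𝒰.chart i).proj x = (𝒰.chart i).proj y → ↑x ∈ B → ↑y ∈ B) → IsOpen[F.leafTopology] B := by
    intro B hB
    refine (@isOpen_iff_forall_mem_open X F.leafTopology B).2 fun y hy => ?_
    obtain ⟨i, hi⟩ := 𝒰.covers y
    refine ⟨(𝒰.chart i).plaque ((𝒰.chart i).proj ⟨y, hi⟩), ?_,
      Lamination.isOpen_plaque (𝒰.mem_charts i) _, hi, rfl⟩
    rintro z ⟨hz, hzy⟩
    exact hB i ⟨y, hi⟩ ⟨z, hz⟩ hzy.symm hy
  refine @IsClopen.connectedComponent_subset X F.leafTopology A x ⟨?_, key A hA⟩ hx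
  exact (@isOpen_compl_iff X A F.leafTopology).1
    (key Aᶜ fun i x y h hx hy => hx (hA i y x h.symm hy))

theorem pathLength_le_iff {γ : I → X} {n : ℕ} :
    𝒰.pathLength γ ≤ n ↔
      ∃ c, 𝒰.IsPlaqueChain c ∧ (∀ t, ∃ p ∈ c, γ t ∈ 𝒰.plaque p) ∧ c.length ≤ n := by
  constructor
  · intro h
    have h' : 𝒰.pathLength γ < ((n + 1 : ℕ) : ℕ∞) := h.trans_lt (by exact_mod_cast n.lt_succ_self)
    obtain ⟨c, hc⟩ := iInf_lt_iff.1 h'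
    obtain ⟨hc, hlt⟩ := iInf_lt_iff.1 hc
    exact ⟨c, hc.1, hc.2, Nat.lt_succ_iff.1 (by exact_mod_cast hlt)⟩
  · rintro ⟨c, hc, hcov, hlen⟩
    exact (iInf₂_le c ⟨hc, hcov⟩).trans (by exact_mod_cast hlen)

theorem homotopyLength_le_iff {V : Set X} {H : C(V × I, X)} {n : ℕ∞} :
    𝒰.homotopyLength H ≤ n ↔ ∀ x : V, 𝒰.pathLength (fun t => H (x, t)) ≤ n :=
  iSup_le_iff

theorem one_le_of_pathLength_le {γ : I → X} {n : ℕ} (h : 𝒰.pathLength γ ≤ n) : 1 ≤ n := by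
  obtain ⟨c, hc, -, hn⟩ := pathLength_le_iff.1 h
  exact (List.length_pos_iff.2 hc.1).trans_le hn

theorem IsPlaqueChain.reverse {c : List 𝒰.PlaqueIndex} (hc : 𝒰.IsPlaqueChain c) :
    𝒰.IsPlaqueChain c.reverse := by
  refine ⟨by simpa using hc.1, ?_⟩
  rw [List.isChain_reverse]
  simpa only [inter_comm] using hc.2

/-- A chain can be continued so that it ends with a given plaque of the chain. -/
theorem IsPlaqueChain.exists_getLast {c : List 𝒰.PlaqueIndex} (hc : 𝒰.IsPlaqueChain c)
    {p : 𝒰.PlaqueIndex} (hp : p ∈ c) :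
    ∃ c', 𝒰.IsPlaqueChain c' ∧ c ⊆ c' ∧ c'.length ≤ 2 * c.length ∧ c'.getLast? = some p := by
  obtain ⟨a, b, rfl⟩ := List.append_of_mem hp
  -- Run to the end of the chain and back to `p`. At the turning point a plaque is followed by
  -- itself, which is allowed since plaques are nonempty.
  refine ⟨(a ++ p :: b) ++ (p :: b).reverse, ⟨by simp, ?_⟩,
    List.subset_append_left _ _, ?_, by rw [List.getLast?_append_of_ne_nil _ (by simp)]; simp⟩
  · refine hc.2.append ?_ ?_
    · exact (IsPlaqueChain.reverse ⟨by simp, hc.2.right_of_append⟩).2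
    · intro x hx y hy
      rw [List.head?_reverse] at hy
      rw [List.getLast?_append_of_ne_nil _ (by simp)] at hx
      obtain rfl : x = y := Option.mem_unique hx hy
      rw [inter_self]
      exact 𝒰.plaque_nonempty x
  · simp only [List.length_append, List.length_reverse]
    omega

/-- A covering chain need not follow the path, so the plaques containing the junction may lie
anywhere in the two chains. Extending each chain to end at such a plaque causes the factors 2. -/
theorem pathLength_concat_le {γ₁ γ₂ γ : I → X} {a b : ℕ} (h₁ : 𝒰.pathLength γ₁ ≤ a)
    (h₂ : 𝒰.pathLength γ₂ ≤ b) {s t : I} (hst : γ₁ s = γ₂ t)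
    (hγ : ∀ t, (∃ s, γ t = γ₁ s) ∨ ∃ s, γ t = γ₂ s) :
    𝒰.pathLength γ ≤ (2 * a + 2 * b : ℕ) := by
  obtain ⟨c₁, hc₁, hcov₁, hlen₁⟩ := pathLength_le_iff.1 h₁
  obtain ⟨c₂, hc₂, hcov₂, hlen₂⟩ := pathLength_le_iff.1 h₂
  obtain ⟨p, hp, hsp⟩ := hcov₁ s
  obtain ⟨q, hq, htq⟩ := hcov₂ t
  obtain ⟨d₁, hd₁, hsub₁, hle₁, hlast₁⟩ := hc₁.exists_getLast hp
  obtain ⟨d₂, hd₂, hsub₂, hle₂, hlast₂⟩ := hc₂.exists_getLast hq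
  refine pathLength_le_iff.2 ⟨d₁ ++ d₂.reverse, ⟨by simp [hd₁.1], ?_⟩, fun r => ?_, ?_⟩
  · refine hd₁.2.append hd₂.reverse.2 ?_
    intro x hx y hy
    rw [List.head?_reverse] at hy
    obtain rfl : x = p := Option.mem_unique hx hlast₁
    obtain rfl : y = q := Option.mem_unique hy hlast₂
    exact ⟨γ₁ s, hsp, hst ▸ htq⟩
  · rcases hγ r with ⟨s', hs'⟩ | ⟨s', hs'⟩
    · obtain ⟨p', hp', h⟩ := hcov₁ s'
      exact ⟨p', List.mem_append_left _ (hsub₁ hp'), hs' ▸ h⟩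
    · obtain ⟨p', hp', h⟩ := hcov₂ s'
      exact ⟨p', List.mem_append_right _ (List.mem_reverse.2 (hsub₂ hp')), hs' ▸ h⟩
  · simp only [List.length_append, List.length_reverse]
    omega

theorem iUnion_cell (𝒰 : RegularAtlas F) : ⋃ i, 𝒰.cell i = univ := by
  refine eq_univ_of_forall fun x => ?_
  obtain ⟨i, hi, hmin⟩ := wellFounded_lt.has_min {i | x ∈ (𝒰.chart i).U} (𝒰.covers x)
  refine mem_iUnion.2 ⟨i, hi, ?_⟩
  simp only [mem_iUnion, not_exists]
  exact fun j hj hxj => hmin j hxj hj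

theorem cell_subset (𝒰 : RegularAtlas F) (i : Fin 𝒰.N) : 𝒰.cell i ⊆ (𝒰.chart i).U :=
  sdiff_subset

theorem isSigmaCompact_inter_cell [T2Space X] [LocallyCompactSpace X] [SecondCountableTopology X]
    {B : Set X} (hB : IsSigmaCompact B) (i : Fin 𝒰.N) : IsSigmaCompact (B ∩ 𝒰.cell i) := by
  have h : IsSigmaCompact (B ∩ (𝒰.chart i).U) := hB.inter (𝒰.chart i).isOpen_U.isSigmaCompact
  have hO : IsOpen (⋃ j : Fin 𝒰.N, ⋃ _ : j < i, (𝒰.chart j).U) :=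
    isOpen_iUnion fun j => isOpen_iUnion fun _ => (𝒰.chart j).isOpen_U
  obtain ⟨K, hK, hKe⟩ := h
  refine ⟨fun n => K n \ ⋃ j : Fin 𝒰.N, ⋃ _ : j < i, (𝒰.chart j).U, fun n => (hK n).diff hO, ?_⟩
  rw [← iUnion_sdiff, hKe, cell, inter_sdiff_assoc]

end RegularAtlas

/-- Concatenation of a homotopy with a homotopy that starts at the inclusion map. -/
theorem exists_concat_homotopy {X : Type*} [TopologicalSpace X] {V W : Set X} (H : C(V × I, X))
    (K : C(W × I, X)) (hK : ∀ z : W, K (z, 0) = z) {V' : Set X} (hV : V' ⊆ V)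
    (hW : ∀ x : V', H (inclusion hV x, 1) ∈ W) :
    ∃ H' : C(V' × I, X), (∀ x, H' (x, 0) = H (inclusion hV x, 0)) ∧
      (∀ x, H' (x, 1) = K (⟨H (inclusion hV x, 1), hW x⟩, 1)) ∧
      ∀ x t, (∃ s, H' (x, t) = H (inclusion hV x, s)) ∨
        ∃ s, H' (x, t) = K (⟨H (inclusion hV x, 1), hW x⟩, s) := by
  have hinc : Continuous (inclusion hV) := continuous_inclusion hV
  let f (t : I) : C(V', X) := ⟨fun x => H (inclusion hV x, t), by fun_prop⟩
  let g (t : I) : C(V', X) := ⟨fun x => K (⟨H (inclusion hV x, 1), hW x⟩, t), by fun_prop⟩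
  let G₁ : ContinuousMap.Homotopy (f 0) (f 1) :=
    { toFun := fun p => H (inclusion hV p.2, p.1)
      continuous_toFun := by fun_prop
      map_zero_left := fun x => rfl
      map_one_left := fun x => rfl }
  let G₂ : ContinuousMap.Homotopy (f 1) (g 1) :=
    { toFun := fun p => K (⟨H (inclusion hV p.2, 1), hW p.2⟩, p.1)
      continuous_toFun := by fun_prop
      map_zero_left := fun x => hK _
      map_one_left := fun x => rfl }
  refine ⟨⟨fun p => G₁.trans G₂ (p.2, p.1), by fun_prop⟩, fun x => ?_, fun x => ?_, fun x t => ?_⟩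
  · exact (G₁.trans G₂).apply_zero x
  · exact (G₁.trans G₂).apply_one x
  · by_cases h : (t : ℝ) ≤ 1 / 2
    · left
      exact ⟨⟨2 * t, (unitInterval.mul_pos_mem_iff zero_lt_two).2 ⟨t.2.1, h⟩⟩,
        (ContinuousMap.Homotopy.trans_apply G₁ G₂ (t, x)).trans (dif_pos h)⟩
    · right
      exact ⟨⟨2 * t - 1, unitInterval.two_mul_sub_one_mem_iff.2 ⟨(not_le.1 h).le, t.2.2⟩⟩,
        (ContinuousMap.Homotopy.trans_apply G₁ G₂ (t, x)).trans (dif_neg h)⟩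

namespace TransverseInvariantMeasure

variable {X : Type u} [TopologicalSpace X] {F : Lamination X} {𝒰 : RegularAtlas F}

theorem eval_mono (Λ : TransverseInvariantMeasure 𝒰) {A B : Set X} (h : A ⊆ B) :
    Λ.eval A ≤ Λ.eval B := by
  refine Finset.sum_le_sum fun i _ => lintegral_mono fun s => ?_
  exact ENat.toENNReal_mono (encard_mono (by gcongr))

/-! ### Measures of transverse sets and of their projections -/

section Measure

variable [T2Space X] [LocallyCompactSpace X] [SecondCountableTopology X]

/-- Since a plaque of one chart meets at most one plaque of another, holonomy carries one projection
of `D` exactly onto the other. -/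
theorem measure_projImage_eq (Λ : TransverseInvariantMeasure 𝒰) {i j : Fin 𝒰.N} {D : Set X}
    (hD : IsSigmaCompact D) (hi : D ⊆ (𝒰.chart i).U) (hj : D ⊆ (𝒰.chart j).U) :
    Λ.measure j ((𝒰.chart j).projImage D) = Λ.measure i ((𝒰.chart i).projImage D) := by
  have himage : 𝒰.holonomyImage i j ((𝒰.chart i).projImage D) = (𝒰.chart j).projImage D := by
    ext t
    constructor
    · rintro ⟨x, hxi, hxj, ⟨y, hy, hyx⟩, rfl⟩
      exact ⟨⟨y, hj hy⟩, hy, 𝒰.plaque_unique i j y x y.2 hxi (hj hy) hxj hyx⟩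
    · rintro ⟨y, hy, rfl⟩
      exact ⟨y, hi hy, y.2, ⟨⟨y, hi hy⟩, hy, rfl⟩, rfl⟩
  rw [← himage]
  refine Λ.invariant i j _ ((𝒰.chart i).isSigmaCompact_projImage hD).measurableSet ?_
  rintro _ ⟨y, hy, rfl⟩
  exact ⟨y, y.2, hj hy, rfl⟩

/-- Cut `B` along the cells and carry each piece to its own chart by holonomy; there a plaque in the
projection contains at least one point of the piece. -/
theorem measure_projImage_le_eval (Λ : TransverseInvariantMeasure 𝒰) {B : Set X}
    (hB : IsSigmaCompact B) (k : Fin 𝒰.N) :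
    Λ.measure k ((𝒰.chart k).projImage B) ≤ Λ.eval B := by
  have hcover : (𝒰.chart k).projImage B ⊆
      ⋃ i, (𝒰.chart k).projImage ((B ∩ 𝒰.cell i) ∩ (𝒰.chart k).U) := by
    simp_rw [FoliatedChart.projImage_inter_U]
    rw [← FoliatedChart.projImage_iUnion, ← inter_iUnion, 𝒰.iUnion_cell, inter_univ]
  refine (measure_mono hcover).trans ((measure_iUnion_fintype_le _ _).trans ?_)
  refine Finset.sum_le_sum fun i _ => ?_
  have hBi := RegularAtlas.isSigmaCompact_inter_cell hB i
  rw [Λ.measure_projImage_eq (hBi.inter (𝒰.chart k).isOpen_U.isSigmaCompact)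
    (inter_subset_left.trans (inter_subset_right.trans (𝒰.cell_subset i))) inter_subset_right]
  refine (measure_mono ((𝒰.chart i).projImage_mono inter_subset_left)).trans ?_
  rw [← lintegral_indicator_one ((𝒰.chart i).isSigmaCompact_projImage hBi).measurableSet]
  refine lintegral_mono fun s => ?_
  refine indicator_apply_le' ?_ fun _ => zero_le
  rintro ⟨x, hx, rfl⟩
  have h1 : 1 ≤ (B ∩ 𝒰.cell i ∩ (𝒰.chart i).plaque ((𝒰.chart i).proj x)).encard :=
    one_le_encard_iff_nonempty.2 ⟨x, hx, (𝒰.chart i).mem_plaque_proj x⟩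
  simpa using ENat.toENNReal_mono h1

/-- When `B` meets each plaque of one chart at most once, so does each piece in its own chart, and
the counting function is at most an indicator. Bounding every piece by the whole projection costs
the factor `N`. -/
theorem eval_le_measure_projImage (Λ : TransverseInvariantMeasure 𝒰) {B : Set X}
    (hB : IsSigmaCompact B) (k : Fin 𝒰.N) (hk : B ⊆ (𝒰.chart k).U)
    (hinj : InjOn (𝒰.chart k).proj ((↑) ⁻¹' B)) :
    Λ.eval B ≤ 𝒰.N * Λ.measure k ((𝒰.chart k).projImage B) := by
  have key : ∀ i, ∫⁻ s, ((B ∩ 𝒰.cell i ∩ (𝒰.chart i).plaque s).encard : ℝ≥0∞) ∂Λ.measure i ≤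
      Λ.measure k ((𝒰.chart k).projImage B) := by
    intro i
    have hBi := RegularAtlas.isSigmaCompact_inter_cell hB i
    have hsub : B ∩ 𝒰.cell i ⊆ (𝒰.chart i).U := inter_subset_right.trans (𝒰.cell_subset i)
    refine le_trans ?_ (measure_mono ((𝒰.chart k).projImage_mono
      (inter_subset_left : B ∩ 𝒰.cell i ⊆ B)))
    rw [Λ.measure_projImage_eq hBi hsub (inter_subset_left.trans hk),
      ← lintegral_indicator_one ((𝒰.chart i).isSigmaCompact_projImage hBi).measurableSet]
    refine lintegral_mono fun s => ?_
    by_cases hs : s ∈ (𝒰.chart i).projImage (B ∩ 𝒰.cell i)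
    · rw [indicator_of_mem hs]
      have h1 : (B ∩ 𝒰.cell i ∩ (𝒰.chart i).plaque s).encard ≤ 1 := by
        refine encard_le_one_iff.2 ?_
        rintro x y ⟨⟨hx, -⟩, hxi, hxs⟩ ⟨⟨hy, -⟩, hyi, hys⟩
        have := hinj (x₁ := ⟨x, hk hx⟩) hx (x₂ := ⟨y, hk hy⟩) hy
          (𝒰.plaque_unique i k x y hxi hyi (hk hx) (hk hy) (hxs.trans hys.symm))
        exact congrArg Subtype.val this
      simpa using ENat.toENNReal_mono h1
    · have h0 : B ∩ 𝒰.cell i ∩ (𝒰.chart i).plaque s = ∅ := by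
        refine eq_empty_of_forall_notMem ?_
        rintro x ⟨hx, hxi, hxs⟩
        exact hs ⟨⟨x, hxi⟩, hx, hxs⟩
      simp [h0]
  calc Λ.eval B ≤ ∑ _i : Fin 𝒰.N, Λ.measure k ((𝒰.chart k).projImage B) :=
        Finset.sum_le_sum fun i _ => key i
    _ = 𝒰.N * Λ.measure k ((𝒰.chart k).projImage B) := by simp

end Measure

/-! ### Controlled deformations and their composition -/

/-- A tangential deformation whose paths have length at most `k`, and whose final map multiplies
the measure of transverse sets by at most `C`. -/
structure IsControlledDeformation (Λ : TransverseInvariantMeasure 𝒰) {W : Set X} (K : C(W × I, X))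
    (k C : ℕ) : Prop where
  map_zero : ∀ z : W, K (z, 0) = z
  mem_leaf : ∀ (z : W) (t : I), K (z, t) ∈ F.leaf z
  length_le : ∀ z : W, 𝒰.pathLength (fun t => K (z, t)) ≤ k
  eval_le : ∀ B : Set W, IsSigmaCompact B →
    Λ.eval ((fun z : W => K (z, 1)) '' B) ≤ C * Λ.eval ((↑) '' B)

theorem isOpen_pullback {V W : Set X} (hV : IsOpen V) (hW : IsOpen W) (H : C(V × I, X)) :
    IsOpen {x | ∃ h : x ∈ V, H (⟨x, h⟩, 1) ∈ W} := by
  have h : IsOpen ((fun x : V => H (x, 1)) ⁻¹' W) := hW.preimage (by fun_prop)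
  convert hV.isOpenMap_subtype_val _ h using 1
  ext x
  simp

theorem IsControlledDeformation.trans {Λ : TransverseInvariantMeasure 𝒰} {V W : Set X}
    {H : C(V × I, X)} {K : C(W × I, X)} {k l C D : ℕ} (hH : Λ.IsControlledDeformation H k C)
    (hK : Λ.IsControlledDeformation K l D) :
    ∃ H' : C({x | ∃ h : x ∈ V, H (⟨x, h⟩, 1) ∈ W} × I, X),
      Λ.IsControlledDeformation H' (2 * k + 2 * l) (C * D) ∧
      ∀ x, H' (x, 1) = K (⟨H (⟨x, x.2.1⟩, 1), x.2.2⟩, 1) := by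
  set V' := {x | ∃ h : x ∈ V, H (⟨x, h⟩, 1) ∈ W}
  have hV : V' ⊆ V := fun x hx => hx.1
  have hW : ∀ x : V', H (inclusion hV x, 1) ∈ W := fun x => x.2.2
  obtain ⟨H', h0, h1, hmem⟩ := exists_concat_homotopy H K hK.map_zero hV hW
  refine ⟨H', ⟨fun x => (h0 x).trans (hH.map_zero _), fun x t => ?_, fun x => ?_, fun B hB => ?_⟩,
    h1⟩
  · have hx := hH.mem_leaf (inclusion hV x)
    rcases hmem x t with ⟨s, hs⟩ | ⟨s, hs⟩
    · exact hs ▸ hx s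
    · rw [hs, Lamination.leaf_eq (hx 1)]
      exact hK.mem_leaf ⟨_, hW x⟩ s
  · refine RegularAtlas.pathLength_concat_le (hH.length_le (inclusion hV x))
      (hK.length_le ⟨_, hW x⟩) (s := 1) (t := 0) ?_ (hmem x)
    exact (hK.map_zero ⟨_, hW x⟩).symm
  · have hinc : Continuous (inclusion hV) := continuous_inclusion hV
    let f : V' → W := fun x => ⟨H (inclusion hV x, 1), hW x⟩
    have hf : Continuous f := by fun_prop
    have e1 : (fun z => H' (z, 1)) '' B = (fun z => K (z, 1)) '' (f '' B) := by
      rw [image_image]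
      exact image_congr fun x _ => h1 x
    have e2 : ((↑) '' (f '' B) : Set X) = (fun z => H (z, 1)) '' (inclusion hV '' B) := by
      rw [image_image, image_image]
    have e3 : ((↑) '' (inclusion hV '' B) : Set X) = (↑) '' B := by
      rw [image_image]
    have h2 := hK.eval_le (f '' B) (hB.image hf)
    have h3 := hH.eval_le (inclusion hV '' B) (hB.image hinc)
    rw [e2] at h2
    rw [e3] at h3
    rw [e1]
    calc _ ≤ _ := h2
      _ ≤ D * (C * Λ.eval ((↑) '' B)) := by gcongr
      _ = _ := by push_cast; ring

/-- Some controlled deformation of a neighborhood of `x` moves `x` to `y`. -/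
def Movable (Λ : TransverseInvariantMeasure 𝒰) (x y : X) : Prop :=
  ∃ W : Set X, IsOpen W ∧ ∃ (hx : x ∈ W) (K : C(W × I, X)) (k C : ℕ),
    Λ.IsControlledDeformation K k C ∧ K (⟨x, hx⟩, 1) = y

theorem Movable.trans {Λ : TransverseInvariantMeasure 𝒰} {x y z : X} (h : Λ.Movable x y)
    (h' : Λ.Movable y z) : Λ.Movable x z := by
  obtain ⟨W, hW, hx, K, k, C, hK, rfl⟩ := h
  obtain ⟨W', hW', hy, K', k', C', hK', rfl⟩ := h'
  obtain ⟨K'', hK'', h1⟩ := hK.trans hK'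
  exact ⟨_, isOpen_pullback hW hW' K, ⟨hx, hy⟩, K'', _, _, hK'', h1 _⟩

/-! ### Deforming neighborhoods into the transversal -/

section Moves

variable [T2Space X] [LocallyCompactSpace X] [SecondCountableTopology X]

/-- Sliding along the plaques of a chart to a local section of its projection. -/
theorem exists_controlledDeformation_section (Λ : TransverseInvariantMeasure 𝒰) (k : Fin 𝒰.N)
    {S' : Set (𝒰.chart k).S} (hS' : IsOpen S') {f : (𝒰.chart k).S → (𝒰.chart k).U}
    (hf : ContinuousOn f S') (hproj : ∀ s ∈ S', (𝒰.chart k).proj (f s) = s) :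
    ∃ W : Set X, IsOpen W ∧ (∀ x : (𝒰.chart k).U, (𝒰.chart k).proj x ∈ S' → ↑x ∈ W) ∧
      ∃ K : C(W × I, X), Λ.IsControlledDeformation K 1 𝒰.N ∧
        ∀ z : W, ∃ h : ↑z ∈ (𝒰.chart k).U, (𝒰.chart k).proj ⟨z, h⟩ ∈ S' ∧
          K (z, 1) = f ((𝒰.chart k).proj ⟨z, h⟩) := by
  let φ := 𝒰.chart k
  let W : Set X := (↑) '' (φ.proj ⁻¹' S')
  have hWo : IsOpen W := φ.isOpen_U.isOpenMap_subtype_val _ (hS'.preimage φ.continuous_proj)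
  have hWU : W ⊆ φ.U := by
    rintro _ ⟨x, -, rfl⟩
    exact x.2
  let ι : W → φ.U := inclusion hWU
  have hι : Continuous ι := continuous_inclusion hWU
  have hιS : ∀ z : W, φ.proj (ι z) ∈ S' := by
    rintro ⟨_, x, hx, rfl⟩
    exact hx
  have hfι : Continuous fun z : W => f (φ.proj (ι z)) :=
    hf.comp_continuous (φ.continuous_proj.comp hι) hιS
  -- The target ball coordinate is that of the section over the plaque of `z`, so the straight slide
  -- ends on the section.
  let b : W → Metric.ball φ.center φ.radius := fun z => (φ.homeo (f (φ.proj (ι z)))).1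
  have hb : Continuous b := continuous_fst.comp (φ.homeo.continuous.comp hfι)
  let G : W × I → φ.U := fun p => φ.slide (b p.1) (ι p.1) p.2
  have hG : Continuous G :=
    φ.continuous_slide (hb.comp continuous_fst) (hι.comp continuous_fst) continuous_snd
  have hGproj : ∀ z t, φ.proj (G (z, t)) = φ.proj (ι z) := fun z t => φ.proj_slide _ _ _
  have hG1 : ∀ z, G (z, 1) = f (φ.proj (ι z)) := by
    intro z
    refine (φ.slide_one _ _).trans ((Homeomorph.symm_apply_eq _).2 (Prod.ext rfl ?_))
    exact (hproj _ (hιS z)).symm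
  refine ⟨W, hWo, fun x hx => ⟨x, hx, rfl⟩,
    ⟨fun p => G p, continuous_subtype_val.comp hG⟩, ⟨fun z => ?_, fun z t => ?_, fun z => ?_,
      fun B hB => ?_⟩, fun z => ⟨hWU z.2, hιS z, congrArg Subtype.val (hG1 z)⟩⟩
  · exact congrArg Subtype.val (φ.slide_zero (b z) (ι z))
  · exact Lamination.mem_leaf_of_proj_eq (𝒰.mem_charts k) (x := ι z) (hGproj z t).symm
  · refine RegularAtlas.pathLength_le_iff.2 ⟨[⟨k, φ.proj (ι z)⟩], ⟨by simp, by simp⟩,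
      fun t => ⟨_, List.mem_singleton_self _, (G (z, t)).2, hGproj z t⟩, le_rfl⟩
  · set r : W → X := fun z => (G (z, 1) : X)
    have hr : Continuous r := by fun_prop
    have hrU : r '' B ⊆ φ.U := by
      rintro _ ⟨z, -, rfl⟩
      exact (G (z, 1)).2
    -- The endpoint depends only on the plaque, so the final image has at most one point in each
    -- plaque.
    have hinj : InjOn φ.proj ((↑) ⁻¹' (r '' B)) := by
      rintro x ⟨z, -, hz⟩ y ⟨w, -, hw⟩ hxy
      obtain rfl : G (z, 1) = x := Subtype.ext hz
      obtain rfl : G (w, 1) = y := Subtype.ext hw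
      rw [hGproj, hGproj] at hxy
      rw [hG1, hG1, hxy]
    have himage : φ.projImage (r '' B) ⊆ φ.projImage ((↑) '' B) := by
      rintro _ ⟨x, ⟨z, hz, hzx⟩, rfl⟩
      obtain rfl : G (z, 1) = x := Subtype.ext hzx
      exact ⟨ι z, ⟨z, hz, rfl⟩, (hGproj z 1).symm⟩
    calc Λ.eval (r '' B) ≤ 𝒰.N * Λ.measure k (φ.projImage (r '' B)) :=
          Λ.eval_le_measure_projImage (hB.image hr) k hrU hinj
      _ ≤ 𝒰.N * Λ.eval ((↑) '' B) := by
          gcongr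
          exact (measure_mono himage).trans
            (Λ.measure_projImage_le_eval (hB.image continuous_subtype_val) k)

theorem movable_of_proj_eq (Λ : TransverseInvariantMeasure 𝒰) {k : Fin 𝒰.N}
    {x y : (𝒰.chart k).U} (h : (𝒰.chart k).proj x = (𝒰.chart k).proj y) : Λ.Movable x y := by
  obtain ⟨W, hW, hmem, K, hK, hK1⟩ := Λ.exists_controlledDeformation_section k isOpen_univ
    (f := fun s => (𝒰.chart k).homeo.symm (((𝒰.chart k).homeo y).1, s))
    (by fun_prop) (fun s _ => by simp [FoliatedChart.proj])
  refine ⟨W, hW, hmem x (mem_univ _), K, 1, 𝒰.N, hK, ?_⟩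
  obtain ⟨_, _, h1⟩ := hK1 ⟨x, hmem x (mem_univ _)⟩
  rw [h1]
  have : (𝒰.chart k).proj ⟨(x : X), x.2⟩ = ((𝒰.chart k).homeo y).2 := h
  simp only [this, Prod.mk.eta, Homeomorph.symm_apply_apply]

/-- The points to which `x` can be moved form a set saturated by plaques, because one more slide
reaches the rest of a plaque; such a set contains the leaf. -/
theorem movable_of_mem_leaf (Λ : TransverseInvariantMeasure 𝒰) {x y : X} (h : y ∈ F.leaf x) :
    Λ.Movable x y := by
  obtain ⟨i, hi⟩ := 𝒰.covers x
  have hx : Λ.Movable x x := Λ.movable_of_proj_eq (k := i) (x := ⟨x, hi⟩) (y := ⟨x, hi⟩) rfl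
  exact 𝒰.leaf_subset (A := {y | Λ.Movable x y})
    (fun i y z hyz hy => Movable.trans hy (Λ.movable_of_proj_eq hyz)) hx h

/-- Every point has a neighborhood with a controlled deformation into a complete transversal. -/
theorem exists_controlledDeformation_transversal (Λ : TransverseInvariantMeasure 𝒰) {T : Set X}
    (hT : F.IsCompleteTransversal T) (x : X) :
    ∃ W : Set X, IsOpen W ∧ x ∈ W ∧ ∃ (K : C(W × I, X)) (k C : ℕ),
      Λ.IsControlledDeformation K k C ∧ ∀ z, K (z, 1) ∈ T := by
  obtain ⟨y, hyx, hyT⟩ := hT.2 x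
  obtain ⟨k, hk⟩ := 𝒰.covers y
  -- The inverse of the local homeomorphism `e` is a local section of the chart projection with
  -- values in `T`.
  obtain ⟨e, he, hfe⟩ := hT.1 _ (𝒰.mem_charts k) ⟨⟨y, hk⟩, hyT⟩
  have hproj : ∀ s ∈ e.target, (𝒰.chart k).proj (e.symm s).1 = s := by
    intro s hs
    exact (congrFun hfe (e.symm s)).trans (e.right_inv hs)
  obtain ⟨W, hW, hmem, K, hK, hK1⟩ := Λ.exists_controlledDeformation_section k e.open_target
    (f := fun s => (e.symm s).1) (continuous_subtype_val.comp_continuousOn e.continuousOn_symm)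
    hproj
  have hyW : y ∈ W := by
    refine hmem ⟨y, hk⟩ ?_
    rw [show (𝒰.chart k).proj ⟨y, hk⟩ = e ⟨⟨y, hk⟩, hyT⟩ from congrFun hfe ⟨⟨y, hk⟩, hyT⟩]
    exact e.map_source he
  obtain ⟨W', hW', hx, K', k', C', hK', rfl⟩ := Λ.movable_of_mem_leaf hyx
  obtain ⟨K'', hK'', h1⟩ := hK'.trans hK
  refine ⟨_, isOpen_pullback hW' hW K', ⟨hx, hyW⟩, K'', _, _, hK'', fun z => ?_⟩
  obtain ⟨_, _, h2⟩ := hK1 ⟨K' (⟨z, z.2.1⟩, 1), z.2.2⟩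
  rw [h1, h2]
  exact (e.symm _).2

end Moves

/-! ### Comparison of the two categories -/

/-- Composing a tangential contraction with a controlled deformation into `T`. -/
theorem tau_pullback_le [T2Space X] [LocallyCompactSpace X] [SecondCountableTopology X]
    (Λ : TransverseInvariantMeasure 𝒰) {T V W : Set X} (hV : IsOpen V) (hW : IsOpen W)
    {H : C(V × I, X)} (hH : F.IsTangentialContraction V H) {n : ℕ}
    (hn : 𝒰.homotopyLength H ≤ n) {K : C(W × I, X)} {k C : ℕ}
    (hK : Λ.IsControlledDeformation K k C) (hKT : ∀ z : W, K (z, 1) ∈ T) :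
    Λ.tau (fun _ H => 𝒰.homotopyLength H ≤ ((2 + 2 * k) * n : ℕ) ∧ finalSet H ⊆ T)
      {x | ∃ h : x ∈ V, H (⟨x, h⟩, 1) ∈ W} ≤ C * Λ.eval (finalSet H) := by
  have hV'o := isOpen_pullback hV hW H
  set V' := {x | ∃ h : x ∈ V, H (⟨x, h⟩, 1) ∈ W}
  have hVV : V' ⊆ V := fun x hx => hx.1
  have hVW : ∀ x : V', H (inclusion hVV x, 1) ∈ W := fun x => x.2.2
  have hinc : Continuous (inclusion hVV) := continuous_inclusion hVV
  obtain ⟨H', h0, h1, hmem⟩ := exists_concat_homotopy H K hK.map_zero hVV hVW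
  -- Leaves of the smaller set lie in leaves of `V`, so the final map of `H` stays constant on them
  -- and composing with `K` preserves this.
  have hleafIn : ∀ x y : V', (y : X) ∈ F.leafIn V' x → (y : X) ∈ F.leafIn V x := fun x _ h =>
    Lamination.leafIn_mono hVV x h
  have hself : ∀ x : V, (x : X) ∈ F.leafIn V x := fun x =>
    @mem_connectedComponentIn X F.leafTopology x V x.2
  have hleaf : ∀ x y : V', (y : X) ∈ F.leafIn V x → ∀ t,
      H' (y, t) ∈ F.leaf (H (inclusion hVV x, 1)) := by
    intro x y hxy t
    rcases hmem y t with ⟨s, hs⟩ | ⟨s, hs⟩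
    · rw [hs]
      exact hH.foliated (inclusion hVV x) (inclusion hVV y) hxy 1 s
    · rw [hs, Lamination.leaf_eq (hH.foliated (inclusion hVV x) (inclusion hVV y) hxy 1 1)]
      exact hK.mem_leaf ⟨_, hVW y⟩ s
  have hH' : F.IsTangentialContraction V' H' := by
    refine ⟨⟨fun x => (h0 x).trans (hH.map_zero _), fun x y hxy s t => ?_⟩, fun x y hxy => ?_⟩
    · rw [← Lamination.leaf_eq (hleaf x x (hself (inclusion hVV x)) s)]
      exact hleaf x y (hleafIn x y hxy) t
    · rw [h1, h1]
      congr 3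
      exact hH.const_one (inclusion hVV x) (inclusion hVV y) (hleafIn x y hxy)
  have hlen : 𝒰.homotopyLength H' ≤ ((2 + 2 * k) * n : ℕ) := by
    refine RegularAtlas.homotopyLength_le_iff.2 fun x => ?_
    have hx := RegularAtlas.homotopyLength_le_iff.1 hn (inclusion hVV x)
    -- A chain is nonempty, so a point of `V'` forces `1 ≤ n`; this absorbs the additive `2 * k`
    -- into a multiple of `n`, and includes the case `n = 0`.
    have hn1 := RegularAtlas.one_le_of_pathLength_le hx
    refine (RegularAtlas.pathLength_concat_le hx (hK.length_le ⟨_, hVW x⟩) (s := 1) (t := 0)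
      (hK.map_zero ⟨_, hVW x⟩).symm (hmem x)).trans ?_
    have : 2 * n + 2 * k ≤ (2 + 2 * k) * n := by nlinarith
    exact_mod_cast this
  have hfinal : finalSet H' ⊆ T := by
    rintro _ ⟨x, rfl⟩
    simp only [h1]
    exact hKT _
  refine (iInf₂_le H' ⟨hH', hlen, hfinal⟩).trans ?_
  let f : V' → W := fun x => ⟨H (inclusion hVV x, 1), hVW x⟩
  have hf : Continuous f := by fun_prop
  have : SigmaCompactSpace V' := isSigmaCompact_iff_sigmaCompactSpace.1 hV'o.isSigmaCompact
  have e1 : finalSet H' = (fun z => K (z, 1)) '' (range f) := by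
    rw [← range_comp]
    exact congrArg range (funext h1)
  have e2 : ((↑) '' (range f) : Set X) ⊆ finalSet H := by
    rintro _ ⟨_, ⟨x, rfl⟩, rfl⟩
    exact ⟨inclusion hVV x, rfl⟩
  rw [e1]
  refine (hK.eval_le _ (isSigmaCompact_range hf)).trans ?_
  gcongr
  exact Λ.eval_mono e2

/-- The category sums over a set of open sets, whereas a family may repeat members. Choosing one
index for each member gives a subsum of the family. -/
theorem catOf_le_tsum (Λ : TransverseInvariantMeasure 𝒰) (P : ∀ V : Set X, C(V × I, X) → Prop)
    {ι : Type*} (V : ι → Set X) (hV : ∀ i, IsOpen (V i)) (hcover : ⋃ i, V i = univ) :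
    Λ.catOf P ≤ ∑' i, Λ.tau P (V i) := by
  refine (iInf₂_le (range V) ⟨forall_mem_range.2 hV, by rwa [sUnion_range]⟩).trans ?_
  have hsec : ∀ W : range V, V W.2.choose = W := fun W => W.2.choose_spec
  have hinj : Function.Injective fun W : range V => W.2.choose := fun A B h =>
    Subtype.ext ((hsec A).symm.trans ((congrArg V h).trans (hsec B)))
  simpa only [hsec] using ENNReal.tsum_comp_le_tsum_of_injective hinj fun i => Λ.tau P (V i)

theorem exists_lt_tau_add (Λ : TransverseInvariantMeasure 𝒰)
    {P : ∀ V : Set X, C(V × I, X) → Prop} {V : Set X} (hV : Λ.tau P V ≠ ∞) {ε : ℝ≥0∞}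
    (hε : 0 < ε) : ∃ H : C(V × I, X), (F.IsTangentialContraction V H ∧ P V H) ∧
      Λ.eval (finalSet H) < Λ.tau P V + ε := by
  obtain ⟨H, hH⟩ := iInf_lt_iff.1 (ENNReal.lt_add_right hV hε.ne')
  obtain ⟨hH, hlt⟩ := iInf_lt_iff.1 hH
  exact ⟨H, hH, hlt⟩

theorem exists_catLenTo_le [T2Space X] [CompactSpace X] [SecondCountableTopology X]
    (Λ : TransverseInvariantMeasure 𝒰) {T : Set X} (hT : F.IsCompleteTransversal T) :
    ∃ B A : ℕ, 0 < A ∧ ∀ n, Λ.catLenTo (B * n) T ≤ A * Λ.catLen n := by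
  choose W hW hxW K k C hK hKT using Λ.exists_controlledDeformation_transversal hT
  obtain ⟨t, ht⟩ := isCompact_univ.elim_finite_subcover W hW
    fun x _ => mem_iUnion.2 ⟨x, hxW x⟩
  have htW : ∀ y, ∃ x : t, y ∈ W x := fun y => by simpa using ht (mem_univ y)
  let B := 2 + 2 * t.sup k
  -- The added 1 keeps `A` nonzero, so that it can be divided out before bounding the infimum over
  -- coverings from below.
  let A := ∑ x : t, C x + 1
  have hA0 : (A : ℝ≥0∞) ≠ 0 := by simp [A]
  have hAtop : (A : ℝ≥0∞) ≠ ∞ := ENNReal.natCast_ne_top _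
  refine ⟨B, A, Nat.succ_pos _, fun n => ?_⟩
  rw [mul_comm (A : ℝ≥0∞), ← ENNReal.div_le_iff hA0 hAtop]
  refine le_iInf₂ fun 𝒱 h𝒱 => ?_
  -- A countable subcovering lets near-optimal contractions be chosen with positive errors `δ V` of
  -- total less than `ε`.
  obtain ⟨𝒱₀, hcount, hsub, hunion⟩ := TopologicalSpace.isOpen_sUnion_countable 𝒱 h𝒱.1
  have := hcount.to_subtype
  set P : ∀ V : Set X, C(V × I, X) → Prop := fun _ H => 𝒰.homotopyLength H ≤ n
  set Q : ∀ V : Set X, C(V × I, X) → Prop :=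
    fun _ H => 𝒰.homotopyLength H ≤ (B * n : ℕ) ∧ finalSet H ⊆ T
  refine le_trans ?_ (ENNReal.tsum_mono_subtype (Λ.tau P) hsub)
  rcases eq_or_ne (∑' V : 𝒱₀, Λ.tau P V) ∞ with htop | htop
  · exact htop ▸ le_top
  refine ENNReal.le_of_forall_pos_le_add fun ε hε _ => ?_
  obtain ⟨δ, hδ, hsum⟩ := ENNReal.exists_pos_sum_of_countable' (ENNReal.coe_ne_zero.2 hε.ne') 𝒱₀
  choose H hH hlt using fun V : 𝒱₀ =>
    Λ.exists_lt_tau_add (ENNReal.ne_top_of_tsum_ne_top htop V) (hδ V)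
  have hopen : ∀ V : 𝒱₀, IsOpen (V : Set X) := fun V => h𝒱.1 V (hsub V.2)
  -- The sets `W` cover all of `X`, in particular the endpoints of each contraction, so these
  -- preimages still cover.
  have hcover : ⋃ p : 𝒱₀ × t, {x | ∃ h : x ∈ (p.1 : Set X), H p.1 (⟨x, h⟩, 1) ∈ W p.2} = univ := by
    refine eq_univ_of_forall fun y => ?_
    obtain ⟨V, hV, hy⟩ : y ∈ ⋃₀ 𝒱₀ := by rw [hunion, h𝒱.2]; trivial
    obtain ⟨x, hx⟩ := htW (H ⟨V, hV⟩ (⟨y, hy⟩, 1))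
    exact mem_iUnion.2 ⟨(⟨V, hV⟩, x), hy, hx⟩
  have hpiece : ∀ (V : 𝒱₀) (x : t),
      Λ.tau Q {y | ∃ h : y ∈ (V : Set X), H V (⟨y, h⟩, 1) ∈ W x} ≤
        C x * Λ.eval (finalSet (H V)) := by
    intro V x
    have hx : k x ≤ t.sup k := Finset.le_sup x.2
    refine le_trans ?_ (Λ.tau_pullback_le (hopen V) (hW x) (hH V).1 (hH V).2 (hK x) (hKT x))
    refine le_iInf₂ fun G hG => iInf₂_le G ⟨hG.1, hG.2.1.trans ?_, hG.2.2⟩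
    have : (2 + 2 * k x) * n ≤ B * n := by
      simp only [B]
      gcongr
    exact_mod_cast this
  rw [ENNReal.div_le_iff hA0 hAtop]
  calc Λ.catOf Q
      ≤ ∑' p : 𝒱₀ × t, Λ.tau Q {y | ∃ h : y ∈ (p.1 : Set X), H p.1 (⟨y, h⟩, 1) ∈ W p.2} :=
        Λ.catOf_le_tsum Q _ (fun p => isOpen_pullback (hopen p.1) (hW p.2) (H p.1)) hcover
    _ ≤ ∑' p : 𝒱₀ × t, C p.2 * Λ.eval (finalSet (H p.1)) :=
        ENNReal.tsum_le_tsum fun p => hpiece p.1 p.2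
    _ = ∑' V : 𝒱₀, (∑ x : t, (C x : ℝ≥0∞)) * Λ.eval (finalSet (H V)) := by
        rw [ENNReal.tsum_prod']
        exact tsum_congr fun V => by rw [tsum_fintype, Finset.sum_mul]
    _ = (∑ x : t, (C x : ℝ≥0∞)) * ∑' V : 𝒱₀, Λ.eval (finalSet (H V)) := ENNReal.tsum_mul_left
    _ ≤ A * ∑' V : 𝒱₀, (Λ.tau P V + δ V) := by
        gcongr with V
        · simp [A]
        · exact (hlt V).le
    _ ≤ (∑' V : 𝒱₀, Λ.tau P V + ε) * A := by
        rw [ENNReal.tsum_add, mul_comm]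
        gcongr

end TransverseInvariantMeasure

theorem propositionp {X : Type u} [TopologicalSpace X] [PolishSpace X] [CompactSpace X]
    (F : Lamination X) (𝒰 : RegularAtlas F) (Λ : TransverseInvariantMeasure 𝒰)
    (hreg : Λ.IsRegular) (hcat : Λ.cat = 0)
    (T : Set X) (hT : F.IsCompleteTransversal T) :
    growthTypeInv Λ.catLen Λ.catLen_antitone =
      growthTypeInv (fun n => Λ.catLenTo n T) (Λ.catLenTo_antitone T) := by
  obtain ⟨B, A, hA, hBA⟩ := Λ.exists_catLenTo_le hT
  refine Quotient.sound ⟨⟨B, A, by exact_mod_cast hA, fun n => ?_⟩, ⟨1, 1, one_pos, fun n => ?_⟩⟩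
  · have hA0 : (A : ℝ≥0∞) ≠ 0 := by exact_mod_cast hA.ne'
    have hAtop : (A : ℝ≥0∞) ≠ ∞ := ENNReal.natCast_ne_top _
    simp only [one_div, ENNReal.ofReal_natCast]
    calc (Λ.catLen n)⁻¹ = A * (A * Λ.catLen n)⁻¹ := by
          rw [ENNReal.mul_inv (.inl hA0) (.inl hAtop), ← mul_assoc,
            ENNReal.mul_inv_cancel hA0 hAtop, one_mul]
      _ ≤ A * (Λ.catLenTo (B * n) T)⁻¹ := by
          gcongr
          exact hBA n
  -- Contractions ending in `T` are among all contractions, so here both constants are 1.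
  · simp only [one_div, ENNReal.ofReal_one, one_mul]
    exact ENNReal.inv_le_inv.2 (Λ.catOf_anti fun _ _ h => h.1)
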